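/- For real $q,t$ with $|q|<1$, $|t|<1$ let $$E_q(t)=\sum_{k=0}^{\infty}\frac{t^k}{\prod_{n=1}^{k}(1-q^n)} .$$ There exist an effective (i.e. computable from $d$ and $v$) positive constant $C_2=C_2(d,v)$ and positive real numbers $\varepsilon_2=\varepsilon_2(d,v,N)$, defined for all integers $d$ with $|d|\ge 2$, all positive integers $v$ and all integers $N$ with $|N|\ge 82836$, such that for all fixed $d,v$ we have $\varepsilon_2(d,v,N)\to 0$ as $|N|\to\infty$, and the following holds. Let $q=1/d$, where $d\in\mathbb{Z}$, $|d|\ge 2$, and let $t=u/v$, where $u\in\mathbb{Z}$, $v\in\mathbb{Z}_{\ge 1}$, $\gcd(u,v)=1$ and $0<|t|<1$. Then $$\left|E_q(t)-\frac{d^s}{N}\right|\ \ge\ C_2\,(2|N|)^{-\left(2+\frac{1}{3+2\sqrt 3}+\varepsilon_2\right)}$$ for all positive integers $s$ and all integers $N$ with $|N|\ge 82836$. -/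

import Mathlib

open Filter Topology

noncomputable section

/-- The `q`-exponential series
`E_q(t) = ∑_{k ≥ 0} t^k / ((1 - q)(1 - q^2) ⋯ (1 - q^k))`,
which converges for `|q| < 1`, `|t| < 1` (see `summable_qExp`). -/
def qExp (q t : ℝ) : ℝ :=
  ∑' k : ℕ, t ^ k / ∏ n ∈ Finset.Icc 1 k, (1 - q ^ n)

/-- The series defining `qExp q t` converges for `|q| < 1` and `|t| < 1`. -/
theorem summable_qExp {q t : ℝ} (hq : |q| < 1) (ht : |t| < 1) :
    Summable (fun k : ℕ => t ^ k / ∏ n ∈ Finset.Icc 1 k, (1 - q ^ n)) := by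
  rcases eq_or_ne t 0 with rfl | h0
  · refine summable_of_ne_finset_zero (s := {0}) ?_
    intro k hk
    have : k ≠ 0 := by simpa using hk
    simp [this]
  have hne : ∀ n : ℕ, 1 ≤ n → (1 - q ^ n) ≠ 0 := by
    intro n hn h
    have h1 : q ^ n = 1 := by linarith
    have h2 : |q| ^ n < 1 := pow_lt_one₀ (abs_nonneg q) hq (by omega)
    rw [← abs_pow, h1] at h2
    simp at h2
  have hprod : ∀ k : ℕ, ∏ n ∈ Finset.Icc 1 k, (1 - q ^ n) ≠ 0 := fun k =>
    Finset.prod_ne_zero_iff.mpr fun n hn => hne n (Finset.mem_Icc.mp hn).1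
  refine summable_of_ratio_test_tendsto_lt_one (l := |t|) ht
    (Eventually.of_forall fun k => div_ne_zero (pow_ne_zero k h0) (hprod k)) ?_
  have hlim : Tendsto (fun k : ℕ => ‖t / (1 - q ^ (k + 1))‖) atTop (𝓝 |t|) := by
    have h1 : Tendsto (fun k : ℕ => q ^ (k + 1)) atTop (𝓝 0) :=
      (tendsto_pow_atTop_nhds_zero_of_abs_lt_one hq).comp (tendsto_add_atTop_nat 1)
    have h2 : Tendsto (fun k : ℕ => t / (1 - q ^ (k + 1))) atTop (𝓝 (t / (1 - 0))) :=
      tendsto_const_nhds.div (tendsto_const_nhds.sub h1) (by norm_num)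
    simpa using h2.norm
  refine hlim.congr fun k => ?_
  rw [← norm_div]
  congr 1
  rw [Finset.prod_Icc_succ_top (by omega : 1 ≤ k + 1)]
  have a := hprod k
  have b := hne (k + 1) (by omega)
  field_simp
  ring

/-- A family of real constants `C d v` is *effective* (a computable function of the integer
parameters `d`, `v`) if some algorithm, given `d`, `v` and a precision `n`, outputs an integer
`a` with `|C d v - a / (n + 1)| ≤ 1 / (n + 1)`. -/
def EffectiveConstant (C : ℤ → ℕ → ℝ) : Prop :=
  ∃ f : ℤ × ℕ × ℕ → ℤ, Computable f ∧
    ∀ (d : ℤ) (v n : ℕ), |C d v - (f (d, v, n) : ℝ) / ((n : ℝ) + 1)| ≤ 1 / ((n : ℝ) + 1)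

end

/-!
Put `q = 1 / d`. The `[n / n]` Padé approximants `Pₙ / Qₙ` of the power series `E_q` are explicit,
and the functional equation `E_q(t q^a) = (t; q)_a E_q(t)` carries their values at the point
`t q^a`, where the remainder is tiny, back to `t`. If `E_q(t)` is close to `d^s / N`, then the
linear form `Qₙ(t q^a) (t; q)_a d^s - Pₙ(t q^a) N` is small; but after multiplication by a suitable
`v^(n + a) d^M` it is an integer, so it is at least `1` in absolute value unless it vanishes. Two
consecutive forms do not vanish simultaneously, because `Qₙ Pₙ₊₁ - Qₙ₊₁ Pₙ` is a nonzero monomial.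
The size of `n` and `a` relative to `√s` is chosen to optimise the resulting bound.
-/

section QAlgebra

open Finset

variable {R S : Type*} [CommRing R] [CommRing S]

/-- The shifted factorial `(x; p)_m = (1 - x)(1 - x p) ⋯ (1 - x p^(m - 1))`. -/
def qPoch (p x : R) (m : ℕ) : R :=
  ∏ i ∈ range m, (1 - x * p ^ i)

/-- The Gaussian binomial coefficient `[i + j choose j]` in base `p`, indexed by the two parts
`i` and `j` so that its Pascal rule involves no subtraction of natural numbers. -/
def gaussBinom (p : R) : ℕ → ℕ → R
  | _, 0 => 1
  | 0, _ + 1 => 1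
  | i + 1, j + 1 => gaussBinom p i (j + 1) + p ^ (i + 1) * gaussBinom p (i + 1) j
termination_by i j => (i, j)

@[simp]
theorem qPoch_zero (p x : R) : qPoch p x 0 = 1 :=
  prod_range_zero _

theorem qPoch_succ (p x : R) (m : ℕ) :
    qPoch p x (m + 1) = qPoch p x m * (1 - x * p ^ m) :=
  prod_range_succ _ _

theorem qPoch_succ_left (p x : R) (m : ℕ) :
    qPoch p x (m + 1) = (1 - x) * qPoch p (x * p) m := by
  simp only [qPoch, prod_range_succ', pow_zero, mul_one, pow_succ', mul_assoc]
  exact mul_comm _ _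

theorem qPoch_add (p x : R) (k m : ℕ) :
    qPoch p x (k + m) = qPoch p x k * qPoch p (x * p ^ k) m := by
  simp only [qPoch, prod_range_add, pow_add, mul_assoc]

theorem prod_Icc_one_sub_pow (q : R) (k : ℕ) :
    ∏ n ∈ Icc 1 k, (1 - q ^ n) = qPoch q q k := by
  induction k with
  | zero => simp
  | succ k ih => rw [prod_Icc_succ_top k.succ_pos, ih, qPoch_succ, pow_succ']

@[simp]
theorem gaussBinom_zero_right (p : R) (i : ℕ) : gaussBinom p i 0 = 1 := by
  simp [gaussBinom]

@[simp]
theorem gaussBinom_zero_left (p : R) (j : ℕ) : gaussBinom p 0 j = 1 := by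
  cases j <;> simp [gaussBinom]

theorem gaussBinom_succ_succ (p : R) (i j : ℕ) : gaussBinom p (i + 1) (j + 1) =
    gaussBinom p i (j + 1) + p ^ (i + 1) * gaussBinom p (i + 1) j := by
  rw [gaussBinom]

theorem map_gaussBinom (f : R →+* S) (p : R) (i j : ℕ) :
    f (gaussBinom p i j) = gaussBinom (f p) i j := by
  induction i generalizing j with
  | zero => simp
  | succ i ih => induction j with
    | zero => simp
    | succ j ihj => simp [gaussBinom_succ_succ, ih, ihj]

theorem gaussBinom_mul_qPoch (p : R) (i j : ℕ) :
    gaussBinom p i j * qPoch p p j = qPoch p (p ^ (i + 1)) j := by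
  induction i generalizing j with
  | zero => simp
  | succ i ihi => induction j with
    | zero => simp
    | succ j ihj =>
      calc gaussBinom p (i + 1) (j + 1) * qPoch p p (j + 1)
          = gaussBinom p i (j + 1) * qPoch p p (j + 1) +
              p ^ (i + 1) * (gaussBinom p (i + 1) j * qPoch p p j) * (1 - p * p ^ j) := by
            rw [gaussBinom_succ_succ, qPoch_succ]
            ring
        _ = qPoch p (p ^ (i + 1 + 1)) (j + 1) := by
            rw [ihi, ihj, qPoch_succ_left, ← pow_succ, qPoch_succ]
            ring

theorem sum_antidiagonal_succ_gaussBinom_mul (p : R) (f : ℕ → ℕ → R) (m : ℕ) :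
    ∑ ij ∈ antidiagonal (m + 1), gaussBinom p ij.1 ij.2 * f ij.1 ij.2 =
      ∑ ij ∈ antidiagonal m, gaussBinom p ij.1 ij.2 *
        (f (ij.1 + 1) ij.2 + p ^ ij.1 * f ij.1 (ij.2 + 1)) := by
  simp only [mul_add, sum_add_distrib]
  cases m with
  | zero => simp [Nat.sum_antidiagonal_succ, add_comm]
  | succ m =>
    rw [Nat.antidiagonal_succ_succ', Nat.sum_antidiagonal_succ',
      Nat.sum_antidiagonal_succ (f := fun ij => gaussBinom p ij.1 ij.2 * (p ^ ij.1 * _))]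
    simp only [sum_cons, sum_map, Function.Embedding.coe_prodMap, Function.Embedding.coeFn_mk,
      Prod.map_fst, Prod.map_snd, Nat.succ_eq_add_one, gaussBinom_zero_left, gaussBinom_zero_right,
      gaussBinom_succ_succ, add_mul, sum_add_distrib, mul_left_comm, mul_assoc, one_mul, pow_zero]
    ring

theorem qPoch_mul_eq_sum_gaussBinom (p x y : R) (m : ℕ) :
    qPoch p (x * y) m =
      ∑ ij ∈ antidiagonal m,
        gaussBinom p ij.1 ij.2 * (y ^ ij.2 * qPoch p y ij.1 * qPoch p x ij.2) := by
  induction m with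
  | zero => simp
  | succ m ih =>
    rw [qPoch_succ, ih, sum_antidiagonal_succ_gaussBinom_mul p
      (fun i j => y ^ j * qPoch p y i * qPoch p x j), sum_mul]
    refine sum_congr rfl fun ij hij => ?_
    rw [← mem_antidiagonal.mp hij, qPoch_succ, qPoch_succ]
    ring

end QAlgebra

section FormalPade

open Finset PowerSeries

theorem eq_C_mul_X_pow_of_coe_eq_X_pow_mul {R : Type*} [CommRing R] {W : Polynomial R} {m : ℕ}
    {r : R⟦X⟧} (hdeg : W.natDegree ≤ m) (hW : (W : R⟦X⟧) = X ^ m * r) :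
    W = Polynomial.C (coeff 0 r) * Polynomial.X ^ m := by
  ext k
  rw [Polynomial.coeff_C_mul_X_pow, ← Polynomial.coeff_coe, hW, coeff_X_pow_mul']
  rcases lt_trichotomy k m with h | rfl | h
  · rw [if_neg (by omega), if_neg h.ne]
  · simp
  · rw [if_neg h.ne', ← coeff_X_pow_mul', ← hW, Polynomial.coeff_coe,
      Polynomial.coeff_eq_zero_of_natDegree_lt (hdeg.trans_lt h)]

variable {K : Type*} [Field K] {p : K}

theorem inv_pow_add_mul_pow (hp0 : p ≠ 0) (l m : ℕ) : p⁻¹ ^ (l + m) * p ^ m = p⁻¹ ^ l := by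
  rw [pow_add, mul_assoc, ← mul_pow, inv_mul_cancel₀ hp0, one_pow, mul_one]

theorem qPoch_ne_zero {x : K} {m : ℕ} (h : ∀ i < m, x * p ^ i ≠ 1) : qPoch p x m ≠ 0 :=
  prod_ne_zero_iff.mpr fun i hi => sub_ne_zero.mpr (h i (mem_range.mp hi)).symm

/-- The formal power series `∑ X^k / (q; q)_k` of the `q`-exponential function. -/
def qExpSeries (q : K) : K⟦X⟧ :=
  mk fun k => (qPoch q q k)⁻¹

theorem coeff_qExpSeries (q : K) (k : ℕ) : coeff k (qExpSeries q) = (qPoch q q k)⁻¹ :=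
  coeff_mk _ _

theorem coeff_succ_qExpSeries_mul {q : K} {k : ℕ} (hq : q ^ (k + 1) ≠ 1) :
    coeff (k + 1) (qExpSeries q) * (1 - q ^ (k + 1)) = coeff k (qExpSeries q) := by
  rw [coeff_qExpSeries, coeff_qExpSeries, qPoch_succ, ← pow_succ', mul_inv, mul_assoc,
    inv_mul_cancel₀ (sub_ne_zero.mpr hq.symm), mul_one]

theorem coeff_X_pow_mul_qExpSeries (hp0 : p ≠ 0) (hp : ∀ k ≠ 0, p ^ k ≠ 1) (j k : ℕ) :
    coeff k (X ^ j * qExpSeries p⁻¹) = qPoch p (p⁻¹ ^ k) j * coeff k (qExpSeries p⁻¹) := by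
  induction j generalizing k with
  | zero => simp
  | succ j ih =>
    rw [pow_succ', mul_assoc, qPoch_succ_left]
    cases k with
    | zero => simp
    | succ k =>
      have hq : p⁻¹ ^ (k + 1) ≠ 1 := by
        simpa only [inv_pow, ne_eq, inv_eq_one] using hp (k + 1) k.succ_ne_zero
      have hshift : p⁻¹ ^ (k + 1) * p = p⁻¹ ^ k := by
        simpa using inv_pow_add_mul_pow hp0 k 1
      rw [coeff_succ_X_mul, ih, hshift, ← coeff_succ_qExpSeries_mul hq]
      ring

/-- The denominator of the `[n / n]` Padé approximant of `qExpSeries p⁻¹`. Its coefficients are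
those of the `q`-Vandermonde identity `qPoch_mul_eq_sum_gaussBinom`, so that the `k`-th coefficient
of `padeDen p n * qExpSeries p⁻¹` acquires the factor `(p^(n + 1 - k); p)_n`, which vanishes for
`n < k ≤ 2 n`. -/
noncomputable def padeDen (p : K) (n : ℕ) : Polynomial K :=
  ∑ ij ∈ antidiagonal n, Polynomial.C
    (gaussBinom p ij.1 ij.2 * ((p ^ (n + 1)) ^ ij.2 * qPoch p (p ^ (n + 1)) ij.1)) *
      Polynomial.X ^ ij.2

/-- The numerator of the `[n / n]` Padé approximant of `qExpSeries p⁻¹`. -/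
noncomputable def padeNum (p : K) (n : ℕ) : Polynomial K :=
  trunc (n + 1) ((padeDen p n : K⟦X⟧) * qExpSeries p⁻¹)

theorem natDegree_padeDen_le (p : K) (n : ℕ) : (padeDen p n).natDegree ≤ n :=
  Polynomial.natDegree_sum_le_of_forall_le _ _ fun _ hij =>
    (Polynomial.natDegree_C_mul_X_pow_le _ _).trans (HasAntidiagonal.antidiagonal.snd_le hij)

theorem natDegree_padeNum_le (p : K) (n : ℕ) : (padeNum p n).natDegree ≤ n :=
  Nat.lt_succ_iff.mp (natDegree_trunc_lt _ n)

theorem eval_padeDen (p x : K) (n : ℕ) : (padeDen p n).eval x = ∑ ij ∈ antidiagonal n,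
    gaussBinom p ij.1 ij.2 * ((p ^ (n + 1)) ^ ij.2 * qPoch p (p ^ (n + 1)) ij.1) * x ^ ij.2 := by
  simp [padeDen, Polynomial.eval_finsetSum]

theorem padeDen_coeff_zero (p : K) (n : ℕ) :
    (padeDen p n).coeff 0 = qPoch p (p ^ (n + 1)) n := by
  rw [Polynomial.coeff_zero_eq_eval_zero, eval_padeDen, sum_eq_single (n, 0)]
  · simp
  · rintro ⟨i, _ | j⟩ hij hne
    · exact absurd (by simpa using hij) hne
    · simp
  · simp

theorem coeff_padeDen_mul_qExpSeries (hp0 : p ≠ 0) (hp : ∀ k ≠ 0, p ^ k ≠ 1) (n k : ℕ) :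
    coeff k ((padeDen p n : K⟦X⟧) * qExpSeries p⁻¹) =
      qPoch p (p⁻¹ ^ k * p ^ (n + 1)) n * coeff k (qExpSeries p⁻¹) := by
  have hcoe : (padeDen p n : K⟦X⟧) = ∑ ij ∈ antidiagonal n,
      C (gaussBinom p ij.1 ij.2 * ((p ^ (n + 1)) ^ ij.2 * qPoch p (p ^ (n + 1)) ij.1)) *
        X ^ ij.2 := by
    rw [padeDen, ← Polynomial.coeToPowerSeries.ringHom_apply, map_sum]
    simp
  rw [hcoe, sum_mul, map_sum, qPoch_mul_eq_sum_gaussBinom, sum_mul]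
  refine sum_congr rfl fun ij _ => ?_
  rw [mul_assoc, coeff_C_mul, coeff_X_pow_mul_qExpSeries hp0 hp]
  ring

theorem coeff_padeDen_mul_qExpSeries_eq_zero (hp0 : p ≠ 0) (hp : ∀ k ≠ 0, p ^ k ≠ 1) {n k : ℕ}
    (hnk : n < k) (hkn : k ≤ 2 * n) : coeff k ((padeDen p n : K⟦X⟧) * qExpSeries p⁻¹) = 0 := by
  rw [coeff_padeDen_mul_qExpSeries hp0 hp, qPoch,
    prod_eq_zero (mem_range.mpr (by omega : k - (n + 1) < n)), zero_mul]
  rw [mul_assoc, ← pow_add, Nat.add_sub_cancel' hnk, ← mul_pow, inv_mul_cancel₀ hp0, one_pow,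
    sub_self]

theorem coeff_two_mul_add_one_padeDen_mul_qExpSeries_ne_zero (hp0 : p ≠ 0)
    (hp : ∀ k ≠ 0, p ^ k ≠ 1) (n : ℕ) :
    coeff (2 * n + 1) ((padeDen p n : K⟦X⟧) * qExpSeries p⁻¹) ≠ 0 := by
  have hq : ∀ k ≠ 0, p⁻¹ ^ k ≠ 1 := fun k hk => by
    simpa only [inv_pow, ne_eq, inv_eq_one] using hp k hk
  rw [coeff_padeDen_mul_qExpSeries hp0 hp, coeff_qExpSeries]
  refine mul_ne_zero (qPoch_ne_zero fun i hi => ?_) (inv_ne_zero (qPoch_ne_zero fun i _ => ?_))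
  · have hexp : 2 * n + 1 = n - i + (n + 1 + i) := by omega
    rw [mul_assoc, ← pow_add, hexp, inv_pow_add_mul_pow hp0]
    exact hq _ (by omega)
  · rw [← pow_succ']
    exact hq _ i.succ_ne_zero

theorem trunc_two_mul_add_one_padeDen_mul_qExpSeries (hp0 : p ≠ 0) (hp : ∀ k ≠ 0, p ^ k ≠ 1)
    (n : ℕ) : trunc (2 * n + 1) ((padeDen p n : K⟦X⟧) * qExpSeries p⁻¹) = padeNum p n := by
  ext k
  rw [padeNum, coeff_trunc, coeff_trunc]
  rcases Nat.lt_or_ge n k with hnk | hkn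
  · rw [if_neg (by omega : ¬ k < n + 1), ite_eq_right_iff]
    exact fun hk => coeff_padeDen_mul_qExpSeries_eq_zero hp0 hp hnk (by omega)
  · rw [if_pos (by omega), if_pos (by omega)]

theorem exists_padeNum_eq_sub (hp0 : p ≠ 0) (hp : ∀ k ≠ 0, p ^ k ≠ 1) (n : ℕ) :
    ∃ r : K⟦X⟧, coeff 0 r ≠ 0 ∧
      (padeNum p n : K⟦X⟧) = (padeDen p n : K⟦X⟧) * qExpSeries p⁻¹ - X ^ (2 * n + 1) * r := by
  refine ⟨mk fun i => coeff (i + (2 * n + 1)) ((padeDen p n : K⟦X⟧) * qExpSeries p⁻¹), ?_, ?_⟩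
  · rw [coeff_mk, zero_add]
    exact coeff_two_mul_add_one_padeDen_mul_qExpSeries_ne_zero hp0 hp n
  · rw [← trunc_two_mul_add_one_padeDen_mul_qExpSeries hp0 hp, eq_sub_iff_add_eq']
    exact (eq_X_pow_mul_shift_add_trunc _ _).symm

theorem exists_pade_det_eq_C_mul_X_pow (hp0 : p ≠ 0) (hp : ∀ k ≠ 0, p ^ k ≠ 1) (n : ℕ) :
    ∃ c : K, c ≠ 0 ∧ padeDen p n * padeNum p (n + 1) - padeDen p (n + 1) * padeNum p n =
      Polynomial.C c * Polynomial.X ^ (2 * n + 1) := by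
  obtain ⟨r, hr0, hr⟩ := exists_padeNum_eq_sub hp0 hp n
  obtain ⟨r', -, hr'⟩ := exists_padeNum_eq_sub hp0 hp (n + 1)
  have hdeg : (padeDen p n * padeNum p (n + 1) - padeDen p (n + 1) * padeNum p n).natDegree ≤
      2 * n + 1 := by
    have hleft := Polynomial.natDegree_mul_le_of_le (natDegree_padeDen_le p n)
      (natDegree_padeNum_le p (n + 1))
    have hright := Polynomial.natDegree_mul_le_of_le (natDegree_padeDen_le p (n + 1))
      (natDegree_padeNum_le p n)
    exact (Polynomial.natDegree_sub_le _ _).trans (max_le (by omega) (by omega))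
  have hseries : ((padeDen p n * padeNum p (n + 1) - padeDen p (n + 1) * padeNum p n :
      Polynomial K) : K⟦X⟧) = X ^ (2 * n + 1) *
        ((padeDen p (n + 1) : K⟦X⟧) * r - X ^ 2 * ((padeDen p n : K⟦X⟧) * r')) := by
    rw [Polynomial.coe_sub, Polynomial.coe_mul, Polynomial.coe_mul, hr, hr']
    ring
  refine ⟨_, ?_, eq_C_mul_X_pow_of_coe_eq_X_pow_mul hdeg hseries⟩
  have hden : (padeDen p (n + 1)).coeff 0 ≠ 0 := by
    rw [padeDen_coeff_zero]
    exact qPoch_ne_zero fun i _ => by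
      rw [← pow_add]
      exact hp _ (by omega)
  rw [coeff_zero_eq_constantCoeff] at hr0 ⊢
  simpa using ⟨hden, hr0⟩

/-- The linear form `Qₙ(x) Y - Pₙ(x) Z` in `Y` and `Z` attached to the `[n / n]` Padé approximant
`Pₙ / Qₙ` of `qExpSeries p⁻¹`; it is small when `Y / Z` is close to `Pₙ(x) / Qₙ(x)`. -/
noncomputable def padeForm (p : K) (n : ℕ) (x Y Z : K) : K :=
  (padeDen p n).eval x * Y - (padeNum p n).eval x * Z

theorem padeForm_ne_zero_or_succ_ne_zero (hp0 : p ≠ 0) (hp : ∀ k ≠ 0, p ^ k ≠ 1) {x Z : K} (Y : K)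
    (hx : x ≠ 0) (hZ : Z ≠ 0) (n : ℕ) :
    padeForm p n x Y Z ≠ 0 ∨ padeForm p (n + 1) x Y Z ≠ 0 := by
  by_contra! h
  obtain ⟨c, hc, hdet⟩ := exists_pade_det_eq_C_mul_X_pow hp0 hp n
  have hdet_eval : (padeDen p n).eval x * (padeNum p (n + 1)).eval x -
      (padeDen p (n + 1)).eval x * (padeNum p n).eval x = c * x ^ (2 * n + 1) := by
    simpa using congrArg (Polynomial.eval x) hdet
  have hvanish : Z * (c * x ^ (2 * n + 1)) = 0 := by
    rw [← hdet_eval]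
    unfold padeForm at h
    linear_combination (padeDen p (n + 1)).eval x * h.1 - (padeDen p n).eval x * h.2
  exact mul_ne_zero hZ (mul_ne_zero hc (pow_ne_zero _ hx)) hvanish

end FormalPade

section Estimates

open Finset

variable {F : Type*} [Field F] [LinearOrder F] [IsStrictOrderedRing F]

theorem pow_ne_one_of_abs_lt_one {q : F} (hq : |q| < 1) {k : ℕ} (hk : k ≠ 0) : q ^ k ≠ 1 := by
  intro h
  have hlt := pow_lt_one₀ (abs_nonneg q) hq hk
  rw [← abs_pow, h, abs_one] at hlt
  exact hlt.false

theorem pow_ne_one_of_one_lt_abs {p : F} (hp : 1 < |p|) {k : ℕ} (hk : k ≠ 0) : p ^ k ≠ 1 := by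
  intro h
  have hlt := one_lt_pow₀ hp hk
  rw [← abs_pow, h, abs_one] at hlt
  exact hlt.false

theorem abs_inv_le_half {p : F} (hp : 2 ≤ |p|) : |p⁻¹| ≤ 1 / 2 := by
  rw [abs_inv, one_div]
  exact inv_anti₀ two_pos hp

theorem natCast_le_pow_of_two_le {x : F} (hx : 2 ≤ x) (n : ℕ) : (n : F) ≤ x ^ n :=
  calc (n : F) ≤ 2 ^ n := by exact_mod_cast n.lt_two_pow_self.le
    _ ≤ x ^ n := by gcongr

theorem abs_qPoch_le_two_pow {p x : F} {m : ℕ} (h : ∀ i < m, |x * p ^ i| ≤ 1) :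
    |qPoch p x m| ≤ 2 ^ m := by
  rw [qPoch, abs_prod]
  refine (prod_le_prod (fun _ _ => abs_nonneg _) fun i hi => ?_).trans_eq
    (by rw [prod_const, card_range])
  calc |1 - x * p ^ i| ≤ |1| + |x * p ^ i| := abs_sub _ _
    _ ≤ 2 := by linarith [h i (mem_range.mp hi), abs_one (α := F)]

theorem abs_qPoch_le_two_pow_of_abs_le_one {p x : F} (hp : |p| ≤ 1) (hx : |x| ≤ 1) (m : ℕ) :
    |qPoch p x m| ≤ 2 ^ m :=
  abs_qPoch_le_two_pow fun i _ => by
    rw [abs_mul, abs_pow]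
    exact mul_le_one₀ hx (by positivity) (pow_le_one₀ (abs_nonneg p) hp)

theorem abs_coeff_qExpSeries_le {q : F} (hq : |q| ≤ 1 / 2) (k : ℕ) :
    |PowerSeries.coeff k (qExpSeries q)| ≤ 2 ^ k := by
  have hfactor : ∀ i ∈ range k, (1 / 2 : F) ≤ |1 - q * q ^ i| := fun i _ => by
    have hqi : |q * q ^ i| ≤ 1 / 2 := by
      rw [abs_mul, abs_pow]
      exact (mul_le_of_le_one_right (abs_nonneg q)
        (pow_le_one₀ (abs_nonneg q) (by linarith))).trans hq
    linarith [abs_sub_abs_le_abs_sub 1 (q * q ^ i), abs_one (α := F)]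
  have hprod : (1 / 2 : F) ^ k ≤ |qPoch q q k| := by
    rw [qPoch, abs_prod, ← card_range k, ← prod_const, card_range]
    exact prod_le_prod (fun _ _ => by positivity) hfactor
  rw [coeff_qExpSeries, abs_inv, inv_le_comm₀ (hprod.trans_lt' (by positivity)) (by positivity)]
  simpa using hprod

theorem abs_gaussBinom_le {p : F} (hp : 1 ≤ |p|) (i j : ℕ) :
    |gaussBinom p i j| ≤ (i + j).choose j * |p| ^ (i * j) := by
  induction i generalizing j with
  | zero => simp
  | succ i ihi => induction j with
    | zero => simp
    | succ j ihj =>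
      have hpow : |p| ^ (i * (j + 1)) ≤ |p| ^ ((i + 1) * (j + 1)) :=
        pow_le_pow_right₀ hp (by nlinarith)
      calc |gaussBinom p (i + 1) (j + 1)|
          ≤ |gaussBinom p i (j + 1)| + |p| ^ (i + 1) * |gaussBinom p (i + 1) j| := by
            rw [gaussBinom_succ_succ, ← abs_pow, ← abs_mul]
            exact abs_add_le _ _
        _ ≤ (i + (j + 1)).choose (j + 1) * |p| ^ ((i + 1) * (j + 1)) +
              |p| ^ (i + 1) * ((i + 1 + j).choose j * |p| ^ ((i + 1) * j)) :=
            add_le_add ((ihi _).trans (by gcongr)) (by gcongr)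
        _ = (i + 1 + (j + 1)).choose (j + 1) * |p| ^ ((i + 1) * (j + 1)) := by
            rw [← add_assoc (i + 1), Nat.choose_succ_succ (i + 1 + j), ← add_assoc i,
              add_right_comm i 1 j]
            push_cast
            ring

theorem abs_qPoch_le_two_mul_pow {p y : F} (hp : 1 ≤ |p|) (hy : 1 ≤ |y|) (m : ℕ) :
    |qPoch p y m| ≤ (2 * |y|) ^ m * |p| ^ m.choose 2 := by
  induction m with
  | zero => simp
  | succ m ih =>
    have hfactor : |1 - y * p ^ m| ≤ 2 * |y| * |p| ^ m := by
      have hone : 1 ≤ |y| * |p| ^ m := one_le_mul_of_one_le_of_one_le hy (one_le_pow₀ hp)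
      calc |1 - y * p ^ m| ≤ |1| + |y * p ^ m| := abs_sub _ _
        _ = 1 + |y| * |p| ^ m := by rw [abs_one, abs_mul, abs_pow]
        _ ≤ 2 * |y| * |p| ^ m := by linarith
    calc |qPoch p y (m + 1)| = |qPoch p y m| * |1 - y * p ^ m| := by rw [qPoch_succ, abs_mul]
      _ ≤ (2 * |y|) ^ m * |p| ^ m.choose 2 * (2 * |y| * |p| ^ m) := by gcongr
      _ = (2 * |y|) ^ (m + 1) * |p| ^ (m + 1).choose 2 := by
        rw [Nat.choose_succ_succ' m 1, Nat.choose_one_right]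
        ring

theorem choose_two_add_mul_le (i j : ℕ) : i.choose 2 + i * j ≤ (i + j).choose 2 := by
  induction j with
  | zero => simp
  | succ j ih =>
    rw [← add_assoc, Nat.choose_succ_succ' (i + j) 1, Nat.choose_one_right]
    linarith

theorem abs_eval_padeDen_le {p x : F} (hp : 1 ≤ |p|) (hx : |x| ≤ 1) (n : ℕ) :
    |(padeDen p n).eval x| ≤ 3 ^ n * |p| ^ ((n + 1) * n + n.choose 2) := by
  have hterm : ∀ ij ∈ antidiagonal n, |gaussBinom p ij.1 ij.2 *
      ((p ^ (n + 1)) ^ ij.2 * qPoch p (p ^ (n + 1)) ij.1) * x ^ ij.2| ≤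
        n.choose ij.1 • (2 ^ ij.1 * 1 ^ ij.2) * |p| ^ ((n + 1) * n + n.choose 2) := by
    rintro ⟨i, j⟩ hij
    obtain rfl : i + j = n := mem_antidiagonal.mp hij
    set y := p ^ (i + j + 1) with hy
    have hy1 : 1 ≤ |y| := by
      rw [hy, abs_pow]
      exact one_le_pow₀ hp
    calc |gaussBinom p i j * (y ^ j * qPoch p y i) * x ^ j|
        ≤ |gaussBinom p i j * (y ^ j * qPoch p y i)| := by
          rw [abs_mul _ (x ^ j), abs_pow x]
          exact mul_le_of_le_one_right (abs_nonneg _) (pow_le_one₀ (abs_nonneg _) hx)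
      _ ≤ (i + j).choose j * |p| ^ (i * j) *
            (|y| ^ j * ((2 * |y|) ^ i * |p| ^ i.choose 2)) := by
          rw [abs_mul, abs_mul, abs_pow]
          gcongr
          exacts [abs_gaussBinom_le hp i j, abs_qPoch_le_two_mul_pow hp hy1 i]
      _ = (i + j).choose i • (2 ^ i * 1 ^ j) *
            |p| ^ ((i + j + 1) * (i + j) + (i.choose 2 + i * j)) := by
          rw [← Nat.choose_symm_add, hy, abs_pow, nsmul_eq_mul]
          ring
      _ ≤ _ := by
          gcongr
          exact choose_two_add_mul_le i j
  have hbinom := (Commute.all (2 : F) 1).add_pow' n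
  rw [two_add_one_eq_three] at hbinom
  rw [eval_padeDen, hbinom, sum_mul]
  exact (abs_sum_le_sum_abs _ _).trans (sum_le_sum hterm)

end Estimates

section Analysis

open Finset PowerSeries

theorem hasSum_coeff_coe_mul {R : Type*} [CommRing R] [TopologicalSpace R] [IsTopologicalRing R]
    {φ : R⟦X⟧} {x s : R} (h : HasSum (fun k => coeff k φ * x ^ k) s) (P : Polynomial R) :
    HasSum (fun k => coeff k ((P : R⟦X⟧) * φ) * x ^ k) (P.eval x * s) := by
  induction P using Polynomial.induction_on' with
  | add P Q hP hQ =>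
    simpa only [Polynomial.coe_add, add_mul, map_add, Polynomial.eval_add] using hP.add hQ
  | monomial m c =>
    have hcoe : ((Polynomial.monomial m c : Polynomial R) : R⟦X⟧) * φ = C c * (X ^ m * φ) := by
      rw [← Polynomial.C_mul_X_pow_eq_monomial, Polynomial.coe_mul, Polynomial.coe_C,
        Polynomial.coe_pow, Polynomial.coe_X, mul_assoc]
    have hshift : HasSum (fun k => coeff k (X ^ m * φ) * x ^ k) (x ^ m * s) := by
      rw [← hasSum_nat_add_iff' m, sum_eq_zero, sub_zero]
      · simp only [coeff_X_pow_mul, pow_add]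
        simpa only [mul_assoc, mul_comm, mul_left_comm] using h.mul_left (x ^ m)
      · intro k hk
        rw [coeff_X_pow_mul', if_neg (by simpa using hk), zero_mul]
    simpa only [hcoe, coeff_C_mul, Polynomial.eval_monomial, mul_assoc] using hshift.mul_left c

variable {q x : ℝ}

theorem hasSum_qExp (hq : |q| < 1) (hx : |x| < 1) :
    HasSum (fun k => coeff k (qExpSeries q) * x ^ k) (qExp q x) := by
  simpa only [qExp, coeff_qExpSeries, prod_Icc_one_sub_pow, div_eq_inv_mul]
    using (summable_qExp hq hx).hasSum

theorem coeff_one_sub_X_mul_qExpSeries (hq : |q| < 1) (k : ℕ) :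
    coeff k ((1 - X) * qExpSeries q) = q ^ k * coeff k (qExpSeries q) := by
  rw [sub_mul, one_mul, map_sub]
  cases k with
  | zero => simp
  | succ k =>
    rw [coeff_succ_X_mul,
      ← coeff_succ_qExpSeries_mul (pow_ne_one_of_abs_lt_one hq k.succ_ne_zero)]
    ring

theorem qExp_mul_left (hq : |q| < 1) (hx : |x| < 1) : qExp q (x * q) = (1 - x) * qExp q x := by
  have hxq : |x * q| < 1 := by
    rw [abs_mul]
    exact mul_lt_one_of_nonneg_of_lt_one_left (abs_nonneg x) hx hq.le
  have hsum := hasSum_coeff_coe_mul (hasSum_qExp hq hx) (1 - Polynomial.X)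
  simp only [Polynomial.coe_sub, Polynomial.coe_one, Polynomial.coe_X,
    coeff_one_sub_X_mul_qExpSeries hq, Polynomial.eval_sub, Polynomial.eval_one,
    Polynomial.eval_X] at hsum
  refine (hasSum_qExp hq hxq).unique ?_
  simpa only [mul_pow, mul_assoc, mul_comm, mul_left_comm] using hsum

theorem qExp_mul_pow (hq : |q| < 1) (hx : |x| < 1) (a : ℕ) :
    qExp q (x * q ^ a) = qPoch q x a * qExp q x := by
  induction a with
  | zero => simp
  | succ a ih =>
    have hxa : |x * q ^ a| < 1 := by
      rw [abs_mul, abs_pow]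
      exact mul_lt_one_of_nonneg_of_lt_one_left (abs_nonneg x) hx
        (pow_le_one₀ (abs_nonneg q) hq.le)
    rw [pow_succ, ← mul_assoc, qExp_mul_left hq hxa, ih, qPoch_succ]
    ring

theorem abs_le_two_mul_of_hasSum_of_le_geometric {f : ℕ → ℝ} {B r s : ℝ} (hs : HasSum f s)
    (hr0 : 0 ≤ r) (hr : r ≤ 1 / 2) (hf : ∀ k, |f k| ≤ B * r ^ k) : |s| ≤ 2 * B := by
  have hB : 0 ≤ B := (abs_nonneg _).trans ((hf 0).trans_eq (by simp))
  have hgeom : |s| ≤ B * (1 - r)⁻¹ :=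
    hs.norm_le_of_bounded ((hasSum_geometric_of_lt_one hr0 (by linarith)).mul_left B) hf
  have hinv : (1 - r)⁻¹ ≤ 2 := by
    rw [inv_le_comm₀ (by linarith) two_pos]
    linarith
  nlinarith

theorem abs_qExp_sub_one_le (hq : |q| ≤ 1 / 2) (hx : |x| ≤ 1 / 8) : |qExp q x - 1| ≤ 1 / 2 := by
  have htail := (hasSum_nat_add_iff' 1).mpr
    (hasSum_qExp (hq.trans_lt one_half_lt_one) (hx.trans_lt (by norm_num)))
  rw [sum_range_one, coeff_qExpSeries, qPoch_zero, pow_zero, inv_one, mul_one] at htail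
  have hbound := abs_le_two_mul_of_hasSum_of_le_geometric (B := 2 * |x|) (r := 2 * |x|) htail
    (by positivity) (by linarith) fun k => by
      rw [abs_mul, abs_pow, ← pow_succ', mul_pow]
      gcongr
      exact abs_coeff_qExpSeries_le hq (k + 1)
  linarith

variable {p : ℝ}

theorem abs_coeff_padeDen_mul_qExpSeries_le (hp : 2 ≤ |p|) {n k : ℕ} (h : 2 * n + 1 ≤ k) :
    |coeff k ((padeDen p n : ℝ⟦X⟧) * qExpSeries p⁻¹)| ≤ 2 ^ n * 2 ^ k := by
  have hp0 : p ≠ 0 := abs_pos.mp (two_pos.trans_le hp)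
  have hq := abs_inv_le_half hp
  rw [coeff_padeDen_mul_qExpSeries hp0 fun _ => pow_ne_one_of_one_lt_abs (by linarith), abs_mul]
  refine mul_le_mul (abs_qPoch_le_two_pow fun i hi => ?_) (abs_coeff_qExpSeries_le hq k)
    (abs_nonneg _) (by positivity)
  rw [mul_assoc, ← pow_add, ← Nat.sub_add_cancel (by omega : n + 1 + i ≤ k),
    inv_pow_add_mul_pow hp0, abs_pow]
  exact pow_le_one₀ (abs_nonneg _) (by linarith)

theorem abs_padeDen_mul_qExp_sub_padeNum_le (hp : 2 ≤ |p|) (hx : |x| ≤ 1 / 4) (n : ℕ) :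
    |(padeDen p n).eval x * qExp p⁻¹ x - (padeNum p n).eval x| ≤
      2 ^ (3 * n + 2) * |x| ^ (2 * n + 1) := by
  have hp0 : p ≠ 0 := abs_pos.mp (two_pos.trans_le hp)
  have hq := (abs_inv_le_half hp).trans_lt one_half_lt_one
  have hsum := hasSum_coeff_coe_mul (hasSum_qExp hq (hx.trans_lt (by norm_num))) (padeDen p n)
  have htrunc : ∑ k ∈ range (2 * n + 1),
      coeff k ((padeDen p n : ℝ⟦X⟧) * qExpSeries p⁻¹) * x ^ k = (padeNum p n).eval x := by
    rw [← trunc_two_mul_add_one_padeDen_mul_qExpSeries hp0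
      fun _ => pow_ne_one_of_one_lt_abs (by linarith)]
    exact (eval₂_trunc_eq_sum_range _ (RingHom.id ℝ) _ _).symm
  have htail := (hasSum_nat_add_iff' (2 * n + 1)).mpr hsum
  rw [htrunc] at htail
  refine (abs_le_two_mul_of_hasSum_of_le_geometric (B := 2 ^ (3 * n + 1) * |x| ^ (2 * n + 1))
    (r := 2 * |x|) htail (by positivity) (by linarith) fun k => ?_).trans_eq (by ring)
  calc |coeff (k + (2 * n + 1)) ((padeDen p n : ℝ⟦X⟧) * qExpSeries p⁻¹) * x ^ (k + (2 * n + 1))|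
      ≤ 2 ^ n * 2 ^ (k + (2 * n + 1)) * |x| ^ (k + (2 * n + 1)) := by
        rw [abs_mul, abs_pow]
        gcongr
        exact abs_coeff_padeDen_mul_qExpSeries_le hp (by omega)
    _ = 2 ^ (3 * n + 1) * |x| ^ (2 * n + 1) * (2 * |x|) ^ k := by ring

end Analysis

section Integrality

open Finset PowerSeries

theorem mul_add_choose_le {a n k : ℕ} (hk : k ≤ n) (hn : n ≤ a) :
    a * k + (n + 1).choose 2 ≤ a * n + (k + 1).choose 2 := by
  induction n, hk using Nat.le_induction with
  | base => rfl
  | succ n _ ih =>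
    have hstep := ih (by omega)
    rw [Nat.choose_succ_succ' (n + 1) 1, Nat.choose_one_right]
    nlinarith

variable {K : Type*} [Field K] {p : K}

theorem coeff_qExpSeries_inv_mul_qPoch (hp0 : p ≠ 0) (hp : ∀ k ≠ 0, p ^ k ≠ 1) (k : ℕ) :
    coeff k (qExpSeries p⁻¹) * qPoch p p k = (-1) ^ k * p ^ (k + 1).choose 2 := by
  induction k with
  | zero => simp [coeff_qExpSeries]
  | succ k ih =>
    have hq : p⁻¹ ^ (k + 1) ≠ 1 := by
      simpa only [inv_pow, ne_eq, inv_eq_one] using hp (k + 1) k.succ_ne_zero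
    have hfactor : 1 - p * p ^ k = -p ^ (k + 1) * (1 - p⁻¹ ^ (k + 1)) := by
      rw [mul_sub, neg_mul, neg_mul, ← mul_pow, mul_inv_cancel₀ hp0]
      ring
    calc coeff (k + 1) (qExpSeries p⁻¹) * qPoch p p (k + 1)
        = -p ^ (k + 1) * (coeff (k + 1) (qExpSeries p⁻¹) * (1 - p⁻¹ ^ (k + 1)) * qPoch p p k) := by
          rw [qPoch_succ, hfactor]
          ring
      _ = (-1) ^ (k + 1) * p ^ (k + 1 + 1).choose 2 := by
          rw [coeff_succ_qExpSeries_mul hq, ih, Nat.choose_succ_succ' (k + 1) 1,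
            Nat.choose_one_right]
          ring

theorem coeff_padeDen_mul_qExpSeries_of_add_eq (hp0 : p ≠ 0) (hp : ∀ k ≠ 0, p ^ k ≠ 1)
    {n i j : ℕ} (hij : i + j = n) : coeff j ((padeDen p n : K⟦X⟧) * qExpSeries p⁻¹) =
      p ^ (j + 1).choose 2 * ((-1) ^ j * (gaussBinom p i j * qPoch p (p ^ (n + 1)) i)) := by
  have hbase : p⁻¹ ^ j * p ^ (n + 1) = p ^ (i + 1) := by
    rw [← hij, add_right_comm, pow_add p (i + 1) j, mul_left_comm, ← mul_pow,
      inv_mul_cancel₀ hp0, one_pow, mul_one]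
  have hsplit : qPoch p (p ^ (i + 1)) n =
      gaussBinom p i j * qPoch p p j * qPoch p (p ^ (n + 1)) i := by
    rw [gaussBinom_mul_qPoch, ← hij, add_comm i j, qPoch_add, ← pow_add]
    congr 3
    omega
  rw [coeff_padeDen_mul_qExpSeries hp0 hp, hbase, hsplit]
  linear_combination gaussBinom p i j * qPoch p (p ^ (n + 1)) i *
    coeff_qExpSeries_inv_mul_qPoch hp0 hp j

variable {A : Subring K} {u v : K}

theorem qPoch_mem {x : K} (hp : p ∈ A) (hx : x ∈ A) (m : ℕ) : qPoch p x m ∈ A :=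
  A.prod_mem fun i _ => A.sub_mem A.one_mem (A.mul_mem hx (A.pow_mem hp i))

theorem gaussBinom_mem (hp : p ∈ A) (i j : ℕ) : gaussBinom p i j ∈ A :=
  map_gaussBinom A.subtype ⟨p, hp⟩ i j ▸ (gaussBinom (⟨p, hp⟩ : A) i j).2

theorem pow_mul_pow_mul_monomial_mem (hp0 : p ≠ 0) (hp : p ∈ A) (hu : u ∈ A) (hv0 : v ≠ 0)
    (hv : v ∈ A) {c : K} (hc : c ∈ A) {a e j M n : ℕ} (hjn : j ≤ n) (hj : a * j ≤ M + e) :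
    v ^ n * p ^ M * (p ^ e * c * (u / v * p⁻¹ ^ a) ^ j) ∈ A := by
  obtain ⟨i, rfl⟩ := Nat.exists_eq_add_of_le hjn
  obtain ⟨r, hr⟩ := Nat.exists_eq_add_of_le hj
  have hcleared : v ^ (j + i) * p ^ M * (p ^ e * c * (u / v * p⁻¹ ^ a) ^ j) =
      v ^ i * u ^ j * p ^ r * c := by
    calc v ^ (j + i) * p ^ M * (p ^ e * c * (u / v * p⁻¹ ^ a) ^ j)
        = v ^ i * (v * (u / v)) ^ j * (p ^ (M + e) * p⁻¹ ^ (a * j)) * c := by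
          rw [mul_pow, ← pow_mul]
          ring
      _ = v ^ i * u ^ j * p ^ r * c := by
          rw [mul_div_cancel₀ u hv0, hr, pow_add, mul_right_comm (p ^ (a * j)), ← mul_pow,
            mul_inv_cancel₀ hp0, one_pow, one_mul]
  rw [hcleared]
  exact A.mul_mem (A.mul_mem (A.mul_mem (A.pow_mem hv i) (A.pow_mem hu j)) (A.pow_mem hp r)) hc

theorem pow_mul_pow_mul_eval_padeDen_mem (hp0 : p ≠ 0) (hp : p ∈ A) (hu : u ∈ A) (hv0 : v ≠ 0)
    (hv : v ∈ A) {n a : ℕ} (hna : n + 1 ≤ a) :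
    v ^ n * p ^ ((a - (n + 1)) * n) * (padeDen p n).eval (u / v * p⁻¹ ^ a) ∈ A := by
  rw [eval_padeDen, mul_sum]
  refine A.sum_mem fun ij hij => ?_
  have hjn : ij.2 ≤ n := HasAntidiagonal.antidiagonal.snd_le hij
  have hexp : a * ij.2 ≤ (a - (n + 1)) * n + (n + 1) * ij.2 := by
    obtain ⟨b, rfl⟩ := Nat.exists_eq_add_of_le hna
    rw [Nat.add_sub_cancel_left]
    nlinarith
  rw [← pow_mul, mul_left_comm (gaussBinom _ _ _)]
  exact pow_mul_pow_mul_monomial_mem hp0 hp hu hv0 hv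
    (A.mul_mem (gaussBinom_mem hp _ _) (qPoch_mem hp (A.pow_mem hp _) _)) hjn hexp

theorem pow_mul_pow_mul_eval_padeNum_mem (hp0 : p ≠ 0) (hp1 : ∀ k ≠ 0, p ^ k ≠ 1) (hp : p ∈ A)
    (hu : u ∈ A) (hv0 : v ≠ 0) (hv : v ∈ A) {n a M : ℕ} (hna : n ≤ a)
    (hM : a * n = M + (n + 1).choose 2) :
    v ^ n * p ^ M * (padeNum p n).eval (u / v * p⁻¹ ^ a) ∈ A := by
  have heval (x : K) : (padeNum p n).eval x =
      ∑ j ∈ range (n + 1), coeff j ((padeDen p n : K⟦X⟧) * qExpSeries p⁻¹) * x ^ j :=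
    eval₂_trunc_eq_sum_range x (RingHom.id K) (n + 1) _
  rw [heval, mul_sum]
  refine A.sum_mem fun j hj => ?_
  have hjn : j ≤ n := Nat.lt_succ_iff.mp (mem_range.mp hj)
  have hexp := mul_add_choose_le hjn hna
  rw [coeff_padeDen_mul_qExpSeries_of_add_eq hp0 hp1 (Nat.sub_add_cancel hjn)]
  exact pow_mul_pow_mul_monomial_mem hp0 hp hu hv0 hv
    (A.mul_mem (A.pow_mem (A.neg_mem A.one_mem) j)
      (A.mul_mem (gaussBinom_mem hp _ _) (qPoch_mem hp (A.pow_mem hp _) _))) hjn (by omega)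

theorem pow_mul_pow_mul_qPoch_inv_mem (hp0 : p ≠ 0) (hp : p ∈ A) (hu : u ∈ A) (hv0 : v ≠ 0)
    (hv : v ∈ A) (a : ℕ) : v ^ a * p ^ a.choose 2 * qPoch p⁻¹ (u / v) a ∈ A := by
  induction a with
  | zero => simp
  | succ a ih =>
    have hfactor : v * p ^ a * (1 - u / v * p⁻¹ ^ a) = v * p ^ a - u := by
      rw [inv_pow]
      field_simp
    have hsplit : v ^ (a + 1) * p ^ (a + 1).choose 2 * qPoch p⁻¹ (u / v) (a + 1) =
        v ^ a * p ^ a.choose 2 * qPoch p⁻¹ (u / v) a * (v * p ^ a - u) := by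
      rw [← hfactor, qPoch_succ, Nat.choose_succ_succ' a 1, Nat.choose_one_right]
      ring
    rw [hsplit]
    exact A.mul_mem ih (A.sub_mem (A.mul_mem hv (A.pow_mem hp a)) hu)

theorem pow_mul_pow_mul_padeForm_mem (hp0 : p ≠ 0) (hp1 : ∀ k ≠ 0, p ^ k ≠ 1) (hp : p ∈ A)
    (hu : u ∈ A) (hv0 : v ≠ 0) (hv : v ∈ A) {Z : K} (hZ : Z ∈ A) {n a M s : ℕ} (hna : n + 1 ≤ a)
    (hM : a * n = M + (n + 1).choose 2) (hs : a.choose 2 + (a - (n + 1)) * n ≤ M + s) :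
    v ^ (n + a) * p ^ M *
      padeForm p n (u / v * p⁻¹ ^ a) (qPoch p⁻¹ (u / v) a * p ^ s) Z ∈ A := by
  have hden := pow_mul_pow_mul_eval_padeDen_mem hp0 hp hu hv0 hv hna
  have hnum := pow_mul_pow_mul_eval_padeNum_mem hp0 hp1 hp hu hv0 hv (by omega) hM
  have hpoch := pow_mul_pow_mul_qPoch_inv_mem hp0 hp hu hv0 hv a
  obtain ⟨r, hr⟩ := Nat.exists_eq_add_of_le hs
  have hpow : p ^ M * p ^ s = p ^ a.choose 2 * p ^ ((a - (n + 1)) * n) * p ^ r := by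
    rw [← pow_add, hr, pow_add, pow_add]
  convert A.sub_mem (A.mul_mem (A.mul_mem hden hpoch) (A.pow_mem hp r))
    (A.mul_mem (A.mul_mem hnum (A.pow_mem hv a)) hZ) using 1
  rw [padeForm, pow_add]
  linear_combination (v ^ n * v ^ a * (padeDen p n).eval (u / v * p⁻¹ ^ a) *
    qPoch p⁻¹ (u / v) a) * hpow

end Integrality

section Approximation

theorem abs_eval_padeDen_le_pow {p x : ℝ} (hp : 2 ≤ |p|) (hx : |x| ≤ 1) (n : ℕ) :
    |(padeDen p n).eval x| ≤ |p| ^ (n * n + n.choose 2 + 3 * n) := by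
  have hthree : (3 : ℝ) ^ n ≤ |p| ^ (2 * n) := by
    rw [pow_mul]
    gcongr
    nlinarith
  calc |(padeDen p n).eval x| ≤ 3 ^ n * |p| ^ ((n + 1) * n + n.choose 2) :=
        abs_eval_padeDen_le (by linarith) hx n
    _ ≤ |p| ^ (2 * n) * |p| ^ ((n + 1) * n + n.choose 2) := by gcongr
    _ = |p| ^ (n * n + n.choose 2 + 3 * n) := by ring

theorem padeForm_qPoch_mul_eq {p : ℝ} (n : ℕ) (x t S : ℝ) {Z : ℝ} (hZ : Z ≠ 0) (a : ℕ) :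
    padeForm p n x (qPoch p⁻¹ t a * S) Z =
      Z * (((padeDen p n).eval x * (qPoch p⁻¹ t a * qExp p⁻¹ t) - (padeNum p n).eval x) -
        (padeDen p n).eval x * qPoch p⁻¹ t a * (qExp p⁻¹ t - S / Z)) := by
  rw [padeForm]
  field_simp
  ring

theorem abs_mul_inv_pow_le {p t : ℝ} (ht : |t| < 1) (a : ℕ) : |t * p⁻¹ ^ a| ≤ |p⁻¹| ^ a := by
  rw [abs_mul, abs_pow]
  exact mul_le_of_le_one_left (by positivity) ht.le

theorem abs_mul_inv_pow_le_quarter {p t : ℝ} (hp : 2 ≤ |p|) (ht : |t| < 1) {a : ℕ} (ha : 2 ≤ a) :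
    |t * p⁻¹ ^ a| ≤ 1 / 4 :=
  calc |t * p⁻¹ ^ a| ≤ |p⁻¹| ^ a := abs_mul_inv_pow_le ht a
    _ ≤ (1 / 2) ^ a := by
        gcongr
        exact abs_inv_le_half hp
    _ ≤ (1 / 2) ^ 2 := pow_le_pow_of_le_one (by norm_num) (by norm_num) ha
    _ = 1 / 4 := by norm_num

theorem abs_padeDen_mul_qPoch_mul_qExp_sub_padeNum_le {p t : ℝ} (hp : 2 ≤ |p|) (ht : |t| < 1)
    {a : ℕ} (ha : 2 ≤ a) (n : ℕ) :
    |(padeDen p n).eval (t * p⁻¹ ^ a) * (qPoch p⁻¹ t a * qExp p⁻¹ t) -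
        (padeNum p n).eval (t * p⁻¹ ^ a)| ≤ |p| ^ (3 * n + 2) / |p| ^ (a * (2 * n + 1)) := by
  rw [← qExp_mul_pow ((abs_inv_le_half hp).trans_lt one_half_lt_one) ht, div_eq_mul_inv, pow_mul,
    ← inv_pow, ← inv_pow, ← abs_inv]
  refine (abs_padeDen_mul_qExp_sub_padeNum_le hp (abs_mul_inv_pow_le_quarter hp ht ha) n).trans ?_
  gcongr
  exact abs_mul_inv_pow_le ht a

theorem abs_padeForm_le {p t Z : ℝ} (hp : 2 ≤ |p|) (ht : |t| < 1) (hZ : Z ≠ 0) {a : ℕ}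
    (ha : 2 ≤ a) (n : ℕ) (S : ℝ) :
    |padeForm p n (t * p⁻¹ ^ a) (qPoch p⁻¹ t a * S) Z| ≤
      |Z| * (|p| ^ (3 * n + 2) / |p| ^ (a * (2 * n + 1)) +
        |p| ^ (n * n + n.choose 2 + 3 * n + a) * |qExp p⁻¹ t - S / Z|) := by
  have hx := abs_mul_inv_pow_le_quarter hp ht ha
  have hq := abs_inv_le_half hp
  have hpoch : |qPoch p⁻¹ t a| ≤ |p| ^ a :=
    (abs_qPoch_le_two_pow_of_abs_le_one (by linarith) ht.le a).trans (by gcongr)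
  rw [padeForm_qPoch_mul_eq n _ t S hZ, abs_mul]
  gcongr
  refine (abs_sub _ _).trans
    (add_le_add (abs_padeDen_mul_qPoch_mul_qExp_sub_padeNum_le hp ht ha n) ?_)
  rw [abs_mul, abs_mul, pow_add |p| _ a]
  gcongr
  exact abs_eval_padeDen_le_pow hp (by linarith) n

/-- The conditions under which the `[n / n]` Padé approximant at the point `u / (v d^a)` yields a
lower bound for the distance from `qExp (1 / d) (u / v)` to `d^s / N`: the factor `v^(n + a) d^M`
clears the denominators of the linear form, and the Padé remainder is negligible against its
reciprocal. -/
structure PadeAdmissible (v s n a M : ℕ) : Prop where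
  order_lt : n < a
  clears_num : a * n = M + (n + 1).choose 2
  clears_den : a.choose 2 + (a - (n + 1)) * n ≤ M + s
  remainder_small : v * (n + a) + M + s + 3 * n + 8 ≤ a * (2 * n + 1)

/-- The exponent `W` of the lower bound `|d|^(-W)` obtained from admissible parameters. -/
def padeExponent (v s n a M : ℕ) : ℕ :=
  v * (n + a) + M + s + 5 + (n * n + n.choose 2 + 3 * n + a) + 1

variable {d u N : ℤ} {v s n a M : ℕ}

theorem PadeAdmissible.two_le (h : PadeAdmissible v s n a M) : 2 ≤ a := by
  by_contra! ha
  have := h.remainder_small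
  have := Nat.mul_le_mul_right (2 * n + 1) (Nat.lt_succ_iff.mp ha)
  omega

theorem one_le_pow_mul_abs_padeForm (h : PadeAdmissible v s n a M) (hd : 2 ≤ |(d : ℝ)|)
    (hv : 1 ≤ v)
    (hne : padeForm (d : ℝ) n (u / v * (d : ℝ)⁻¹ ^ a)
      (qPoch (d : ℝ)⁻¹ (u / v) a * (d : ℝ) ^ s) N ≠ 0) :
    1 ≤ |(d : ℝ)| ^ (v * (n + a) + M) * |padeForm (d : ℝ) n (u / v * (d : ℝ)⁻¹ ^ a)
      (qPoch (d : ℝ)⁻¹ (u / v) a * (d : ℝ) ^ s) N| := by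
  have hd0 : (d : ℝ) ≠ 0 := abs_pos.mp (two_pos.trans_le hd)
  have hv0 : (v : ℝ) ≠ 0 := by positivity
  have hint (m : ℤ) : (m : ℝ) ∈ (Int.castRingHom ℝ).range := ⟨m, rfl⟩
  obtain ⟨z, hz⟩ := pow_mul_pow_mul_padeForm_mem hd0
    (fun _ => pow_ne_one_of_one_lt_abs (by linarith)) (hint d) (hint u) hv0
    (by exact_mod_cast hint v) (hint N) h.order_lt h.clears_num h.clears_den
  rw [eq_intCast] at hz
  have hz0 : z ≠ 0 := by
    rintro rfl
    rw [Int.cast_zero] at hz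
    exact mul_ne_zero (mul_ne_zero (pow_ne_zero _ hv0) (pow_ne_zero _ hd0)) hne hz.symm
  calc (1 : ℝ) ≤ |(z : ℝ)| := by exact_mod_cast Int.one_le_abs hz0
    _ = (v : ℝ) ^ (n + a) * |(d : ℝ)| ^ M * |padeForm (d : ℝ) n (u / v * (d : ℝ)⁻¹ ^ a)
          (qPoch (d : ℝ)⁻¹ (u / v) a * (d : ℝ) ^ s) N| := by
        rw [hz, abs_mul, abs_mul, abs_pow, abs_pow, Nat.abs_cast]
    _ ≤ _ := by
        rw [pow_add |(d : ℝ)|, pow_mul]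
        gcongr
        exact natCast_le_pow_of_two_le hd v

theorem inv_pow_padeExponent_le_abs_sub (h : PadeAdmissible v s n a M) (hd : 2 ≤ |(d : ℝ)|)
    (hv : 1 ≤ v) (ht : |(u : ℝ) / v| < 1) (hN0 : N ≠ 0) (hN : |(N : ℝ)| ≤ 32 * |(d : ℝ)| ^ s)
    (hne : padeForm (d : ℝ) n (u / v * (d : ℝ)⁻¹ ^ a)
      (qPoch (d : ℝ)⁻¹ (u / v) a * (d : ℝ) ^ s) N ≠ 0) :
    (|(d : ℝ)| ^ padeExponent v s n a M)⁻¹ ≤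
      |qExp (d : ℝ)⁻¹ (u / v) - (d : ℝ) ^ s / N| := by
  have hlower := one_le_pow_mul_abs_padeForm h hd hv hne
  have hupper := abs_padeForm_le hd ht (Int.cast_ne_zero.mpr hN0) h.two_le n ((d : ℝ) ^ s)
  set D := |(d : ℝ)|
  set δ := |qExp (d : ℝ)⁻¹ (u / v) - (d : ℝ) ^ s / N|
  have hD1 : 1 ≤ D := by linarith
  have hND : |(N : ℝ)| ≤ D ^ (s + 5) :=
    calc |(N : ℝ)| ≤ 2 ^ 5 * D ^ s := hN.trans_eq (by norm_num)
      _ ≤ D ^ 5 * D ^ s := by gcongr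
      _ = D ^ (s + 5) := by ring
  set B := D ^ (v * (n + a) + M + s + 5) with hB
  have hmain : 1 ≤ B * (D ^ (3 * n + 2) / D ^ (a * (2 * n + 1))) +
      B * D ^ (n * n + n.choose 2 + 3 * n + a) * δ := by
    refine (hlower.trans (mul_le_mul_of_nonneg_left (hupper.trans
      (mul_le_mul_of_nonneg_right hND (by positivity))) (by positivity))).trans_eq ?_
    rw [hB]
    ring
  have hsmall : B * (D ^ (3 * n + 2) / D ^ (a * (2 * n + 1))) ≤ 1 / 2 := by
    rw [← mul_div_assoc, div_le_div_iff₀ (by positivity) two_pos, one_mul]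
    calc B * D ^ (3 * n + 2) * 2 ≤ B * D ^ (3 * n + 2) * D := by gcongr
      _ = D ^ (v * (n + a) + M + s + 3 * n + 8) := by
          rw [hB]
          ring
      _ ≤ D ^ (a * (2 * n + 1)) := pow_le_pow_right₀ hD1 h.remainder_small
  rw [inv_le_iff_one_le_mul₀ (by positivity)]
  calc 1 ≤ B * D ^ (n * n + n.choose 2 + 3 * n + a) * δ * 2 := by linarith
    _ ≤ B * D ^ (n * n + n.choose 2 + 3 * n + a) * δ * D := by gcongr
    _ = δ * D ^ padeExponent v s n a M := by
        rw [hB, padeExponent]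
        ring

end Approximation

section Parameters

/-- The exponent `2 + 1 / (3 + 2√3)` of the main theorem. -/
noncomputable def approxExponent : ℝ := 2 + 1 / (3 + 2 * √3)

/-- The size of `s` (depending on the denominator `v`) from which admissible Padé parameters are
available. -/
def padeThreshold (v : ℕ) : ℕ := 4 * (2 * v + 14) ^ 2

/-- The coefficient of `√s + 1` in the amount by which `padeExponent` exceeds its main term
`approxExponent * s`. -/
def padeLoss (v : ℕ) : ℕ := 20 * (2 * v + 12) ^ 2

theorem exists_padeAdmissible_of_le {v s n a : ℕ} (hna : n < a) (hden : a * a ≤ 2 * s + n * n)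
    (hrem : 2 * s + 2 * v * (n + a) + 5 * n + 16 ≤ 2 * a * n + n * n + 2 * a) :
    ∃ M, PadeAdmissible v s n a M ∧ 2 * padeExponent v s n a M =
      2 * s + 2 * a * n + 2 * n * n + 2 * v * (n + a) + 4 * n + 2 * a + 12 := by
  obtain ⟨b, rfl⟩ := Nat.exists_eq_add_of_le hna
  have hchoose (k : ℕ) : (k + 1) * k = (k + 1).choose 2 * 2 := by
    simpa using Nat.add_one_mul_choose_eq k 1
  have hn := hchoose n
  have ha := hchoose (n + b)
  have hpascal : (n + 1).choose 2 = n + n.choose 2 := by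
    rw [Nat.choose_succ_succ' n 1, Nat.choose_one_right]
  have hle : (n + 1).choose 2 ≤ (n + 1 + b) * n := by nlinarith
  obtain ⟨M, hM⟩ := Nat.exists_eq_add_of_le' hle
  rw [add_right_comm n b 1] at ha
  refine ⟨M, ⟨hna, hM, ?_, by nlinarith⟩, ?_⟩
  · rw [Nat.succ_eq_add_one, Nat.add_sub_cancel_left]
    nlinarith
  · rw [padeExponent]
    nlinarith

theorem scaled_remainder_le {w l v n a : ℝ} (hw : 0 ≤ w) (hl : 1 ≤ l) (hv : 0 ≤ v)
    (hn : l + (2 * v + 10) ≤ n) (hn' : n ≤ l + (2 * v + 12))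
    (ha : a ≤ (1 + w) * l) (ha' : (1 + w) * l ≤ a + 1) :
    2 * ((3 / 2 + w) * (l * l)) + 2 * v * (n + a) + 5 * n + 16 ≤ 2 * a * n + n * n + 2 * a := by
  have hwl : 0 ≤ w * l := by positivity
  have hvl : 0 ≤ v * l := by positivity
  have hwlv : 0 ≤ w * l * v := by positivity
  have hmul : ((1 + w) * l - 1) * (l + (2 * v + 10) + 1) ≤ a * (n + 1) :=
    mul_le_mul (by linarith) (by linarith) (by linarith) (by linarith)
  have hsq : (l + (2 * v + 10)) * (n - 5 / 2) ≤ n * (n - 5 / 2) :=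
    mul_le_mul_of_nonneg_right hn (by linarith)
  have hlin : v * (n + a) ≤ v * ((l + (2 * v + 12)) + (1 + w) * l) := by gcongr
  nlinarith

theorem scaled_exponent_le {w l v n a r : ℝ} (hw : 0 ≤ w) (hw' : w ≤ 1.8) (hl : 0 ≤ l)
    (hv : 0 ≤ v) (hn0 : 0 ≤ n) (ha0 : 0 ≤ a) (hn : n ≤ l + (2 * v + 12))
    (ha : a ≤ (1 + w) * l) (hr : l ≤ r) :
    2 * a * n + 2 * n * n + 2 * v * (n + a) + 4 * n + 2 * a + 12 ≤
      2 * ((2 + w) * (l * l) + 20 * (2 * v + 12) ^ 2 * (r + 1)) := by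
  obtain ⟨g, hg⟩ : ∃ g : ℝ, g = 2 * v + 12 := ⟨_, rfl⟩
  rw [← hg] at hn ⊢
  have hg12 : 12 ≤ g := by linarith
  have hvg : v ≤ g := by linarith
  have hwl : w * l ≤ 1.8 * l := by gcongr
  have hna : n + a ≤ l + g + 3 * l := by linarith
  have han : a * n ≤ (1 + w) * l * (l + g) := by gcongr
  have hnn : n * n ≤ (l + g) * (l + g) := by gcongr
  have hvna : v * (n + a) ≤ g * (l + g + 3 * l) := by gcongr
  have hwlg : w * l * g ≤ 1.8 * l * g := by gcongr
  have hggr : g * g * l ≤ g * g * r := by gcongr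
  have hgl : 12 * l ≤ g * l := by gcongr
  have hggl : 12 * (g * l) ≤ g * (g * l) := by gcongr
  have hgg : 12 * g ≤ g * g := by gcongr
  linarith

-- The bound is best when the two constraints `a² ≤ 2s + n²` (integrality) and `s ≤ an + n²/2`
-- (small remainder) are both tight to leading order, that is when `a = (1 + √3) n` and
-- `s = (3/2 + √3) n²`.
theorem exists_padeAdmissible {v s n a : ℕ} {l : ℝ} (hl : (3 / 2 + √3) * (l * l) = s)
    (hlv : 2 * v + 14 ≤ l) (hn : l + (2 * v + 10) ≤ n) (hn' : n ≤ l + (2 * v + 12))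
    (ha : a ≤ (1 + √3) * l) (ha' : (1 + √3) * l ≤ a + 1) :
    ∃ M, PadeAdmissible v s n a M ∧
      (padeExponent v s n a M : ℝ) ≤ approxExponent * s + padeLoss v * (√s + 1) := by
  have hw0 := Real.sqrt_nonneg 3
  have hw2 : √3 * √3 = 3 := Real.mul_self_sqrt (by norm_num)
  have hw_le : √3 ≤ 1.8 := by nlinarith
  have hv0 : (0 : ℝ) ≤ v := v.cast_nonneg
  have hl0 : 0 ≤ l := by linarith
  have hna : n < a := by
    have : 1.7 * l ≤ √3 * l := by
      gcongr
      nlinarith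
    exact_mod_cast (by linarith : (n : ℝ) < a)
  have hden : (a : ℝ) * a ≤ 2 * s + n * n :=
    calc (a : ℝ) * a ≤ ((1 + √3) * l) * ((1 + √3) * l) := by gcongr
      _ = 2 * s + l * l := by
          rw [← hl]
          linear_combination l * l * hw2
      _ ≤ 2 * s + n * n := by
          gcongr <;> linarith
  have hrem := scaled_remainder_le hw0 (by linarith) hv0 hn hn' ha ha'
  rw [hl] at hrem
  obtain ⟨M, hadm, hW⟩ := exists_padeAdmissible_of_le (v := v) hna (by exact_mod_cast hden)
    (by exact_mod_cast hrem)
  refine ⟨M, hadm, ?_⟩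
  have hmain : approxExponent * s = s + (2 + √3) * (l * l) := by
    rw [approxExponent, ← hl]
    field_simp
    ring
  have hls : l ≤ √s := Real.le_sqrt_of_sq_le (by nlinarith)
  have hexp := scaled_exponent_le hw0 hw_le hl0 hv0 n.cast_nonneg a.cast_nonneg hn' ha hls
  have hW_real : (2 * padeExponent v s n a M : ℝ) =
      2 * s + 2 * a * n + 2 * n * n + 2 * v * (n + a) + 4 * n + 2 * a + 12 := by
    exact_mod_cast hW
  rw [hmain, padeLoss]
  push_cast
  linarith

theorem exists_forall_padeAdmissible {v s : ℕ} (hs : padeThreshold v ≤ s) :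
    ∃ n a : ℕ, ∀ m, m = n ∨ m = n + 1 → ∃ M, PadeAdmissible v s m a M ∧
      (padeExponent v s m a M : ℝ) ≤ approxExponent * s + padeLoss v * (√s + 1) := by
  set l := √(s / (3 / 2 + √3)) with hl_def
  have hl0 : 0 ≤ l := Real.sqrt_nonneg _
  have hl : (3 / 2 + √3) * (l * l) = s := by
    rw [hl_def, Real.mul_self_sqrt (by positivity)]
    field_simp
  have hlv : 2 * (v : ℝ) + 14 ≤ l := by
    have hs_real : 4 * (2 * (v : ℝ) + 14) ^ 2 ≤ s := by exact_mod_cast hs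
    have hw : √3 ≤ 5 / 2 := (Real.sqrt_le_left (by norm_num)).mpr (by norm_num)
    refine abs_le_of_sq_le_sq' ?_ hl0 |>.2
    nlinarith [mul_self_nonneg l]
  refine ⟨⌈l⌉₊ + (2 * v + 10), ⌊(1 + √3) * l⌋₊, fun m hm => exists_padeAdmissible hl hlv ?_ ?_
    (Nat.floor_le (by positivity)) (Nat.lt_floor_add_one _).le⟩
  · rcases hm with rfl | rfl <;> push_cast <;> linarith [Nat.le_ceil l]
  · rcases hm with rfl | rfl <;> push_cast <;> linarith [Nat.ceil_lt_add_one hl0]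

theorem rpow_neg_le_abs_qExp_sub {d u N : ℤ} {v s : ℕ} (hd : 2 ≤ |(d : ℝ)|) (hv : 1 ≤ v)
    (hu : u ≠ 0) (ht : |(u : ℝ) / v| < 1) (hs : padeThreshold v ≤ s) (hN0 : N ≠ 0)
    (hN : |(N : ℝ)| ≤ 32 * |(d : ℝ)| ^ s) :
    |(d : ℝ)| ^ (-(approxExponent * s + padeLoss v * (√s + 1))) ≤
      |qExp (d : ℝ)⁻¹ (u / v) - (d : ℝ) ^ s / N| := by
  have hd0 : (d : ℝ) ≠ 0 := abs_pos.mp (two_pos.trans_le hd)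
  obtain ⟨n, a, hna⟩ := exists_forall_padeAdmissible hs
  have hx : (u : ℝ) / v * (d : ℝ)⁻¹ ^ a ≠ 0 :=
    mul_ne_zero (div_ne_zero (Int.cast_ne_zero.mpr hu) (by positivity)) (by positivity)
  obtain ⟨m, hm, hne⟩ : ∃ m, (m = n ∨ m = n + 1) ∧ padeForm (d : ℝ) m (u / v * (d : ℝ)⁻¹ ^ a)
      (qPoch (d : ℝ)⁻¹ (u / v) a * (d : ℝ) ^ s) N ≠ 0 := by
    rcases padeForm_ne_zero_or_succ_ne_zero hd0
      (fun _ => pow_ne_one_of_one_lt_abs (by linarith))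
      (qPoch (d : ℝ)⁻¹ (u / v) a * (d : ℝ) ^ s) hx (Int.cast_ne_zero.mpr hN0) n with h | h
    exacts [⟨n, .inl rfl, h⟩, ⟨n + 1, .inr rfl, h⟩]
  obtain ⟨M, hadm, hW⟩ := hna m hm
  calc |(d : ℝ)| ^ (-(approxExponent * s + padeLoss v * (√s + 1)))
      ≤ |(d : ℝ)| ^ (-(padeExponent v s m a M : ℝ)) :=
        Real.rpow_le_rpow_of_exponent_le (by linarith) (neg_le_neg hW)
    _ = (|(d : ℝ)| ^ padeExponent v s m a M)⁻¹ := by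
        rw [Real.rpow_neg (abs_nonneg _), Real.rpow_natCast]
    _ ≤ _ := inv_pow_padeExponent_le_abs_sub hadm hd hv ht hN0 hN hne

end Parameters

section LowerBound

theorem abs_qPoch_three_mul_qExp_sub_one_le {q t : ℝ} (hq : |q| ≤ 1 / 2) (ht : |t| < 1) :
    |qPoch q t 3 * qExp q t - 1| ≤ 1 / 2 := by
  rw [← qExp_mul_pow (hq.trans_lt one_half_lt_one) ht]
  refine abs_qExp_sub_one_le hq ?_
  rw [abs_mul, abs_pow]
  calc |t| * |q| ^ 3 ≤ 1 * (1 / 2) ^ 3 := by gcongr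
    _ = 1 / 8 := by norm_num

theorem one_div_sixteen_le_abs_qExp {q t : ℝ} (hq : |q| ≤ 1 / 2) (ht : |t| < 1) :
    1 / 16 ≤ |qExp q t| := by
  have hpoch : |qPoch q t 3| ≤ 2 ^ 3 := abs_qPoch_le_two_pow_of_abs_le_one (by linarith) ht.le 3
  have hprod : 1 / 2 ≤ |qPoch q t 3| * |qExp q t| := by
    rw [← abs_mul]
    linarith [(abs_le.mp (abs_qPoch_three_mul_qExp_sub_one_le hq ht)).1,
      le_abs_self (qPoch q t 3 * qExp q t)]
  linarith [mul_le_mul_of_nonneg_right hpoch (abs_nonneg (qExp q t))]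

theorem abs_one_sub_mul_abs_qExp_le {q t : ℝ} (hq : |q| ≤ 1 / 2) (ht : |t| < 1) :
    |1 - t| * |qExp q t| ≤ 6 := by
  have hfactor {y : ℝ} (hy : |y| ≤ 1 / 2) : 1 / 2 ≤ |1 - t * y| := by
    have hty : |t * y| ≤ 1 / 2 := by
      rw [abs_mul]
      exact (mul_le_of_le_one_left (abs_nonneg y) ht.le).trans hy
    linarith [le_abs_self (1 - t * y), le_abs_self (t * y)]
  have hq2 : |q ^ 2| ≤ 1 / 2 := by
    rw [abs_pow]
    nlinarith [abs_nonneg q]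
  have hprod : |qPoch q t 3 * qExp q t| ≤ 3 / 2 := by
    have := abs_le.mp (abs_qPoch_three_mul_qExp_sub_one_le hq ht)
    exact abs_le.mpr ⟨by linarith, by linarith⟩
  have hpoch : qPoch q t 3 = (1 - t) * (1 - t * q) * (1 - t * q ^ 2) := by
    simp only [qPoch_succ, qPoch_zero, one_mul, pow_zero, mul_one, pow_one]
  have hlower : |1 - t| * |qExp q t| * (1 / 2 * (1 / 2)) ≤ |qPoch q t 3 * qExp q t| :=
    calc |1 - t| * |qExp q t| * (1 / 2 * (1 / 2))
        ≤ |1 - t| * |qExp q t| * (|1 - t * q| * |1 - t * q ^ 2|) := by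
          gcongr
          exacts [hfactor hq, hfactor hq2]
      _ = |qPoch q t 3 * qExp q t| := by
          rw [hpoch, abs_mul, abs_mul, abs_mul]
          ring
  linarith

theorem abs_qExp_div_le {q : ℝ} {u : ℤ} {v : ℕ} (hq : |q| ≤ 1 / 2) (hv : 1 ≤ v)
    (ht : |(u : ℝ) / v| < 1) : |qExp q (u / v)| ≤ 6 * v := by
  have hv_pos : (0 : ℝ) < v := by exact_mod_cast hv
  have hint : (1 : ℝ) ≤ |(v : ℝ) - u| := by
    have hne : (v : ℤ) - u ≠ 0 := by
      intro h
      have huv : (u : ℝ) = v := by exact_mod_cast (sub_eq_zero.mp h).symm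
      rw [huv, div_self hv_pos.ne', abs_one] at ht
      exact lt_irrefl _ ht
    exact_mod_cast Int.one_le_abs hne
  calc |qExp q (u / v)| ≤ |(v : ℝ) - u| * |qExp q (u / v)| :=
        le_mul_of_one_le_left (abs_nonneg _) hint
    _ = |1 - (u : ℝ) / v| * |qExp q (u / v)| * v := by
        rw [show (v : ℝ) - u = (1 - u / v) * v by field_simp, abs_mul, Nat.abs_cast]
        ring
    _ ≤ 6 * v := by
        gcongr
        exact abs_one_sub_mul_abs_qExp_le hq ht

theorem approxExponent_nonneg : 0 ≤ approxExponent := by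
  rw [approxExponent]
  positivity

theorem approxExponent_le_three : approxExponent ≤ 3 := by
  have : 1 / (3 + 2 * √3) ≤ 1 :=
    (div_le_one (by positivity)).mpr (by linarith [Real.sqrt_nonneg 3])
  rw [approxExponent]
  linarith

/-- The coefficient of the error term, of order `√ℓ`, in the lower bound `|d|^(-(μ ℓ + ⋯))` with
`μ = approxExponent` and `ℓ = log_|d| (2 |N|)`. -/
def errorCoeff (v : ℕ) : ℕ :=
  (3 + padeLoss v) * (padeThreshold v + v + 3) + padeLoss v

theorem five_le_errorCoeff (v : ℕ) : 5 ≤ errorCoeff v := by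
  have : 5 ≤ padeLoss v := by
    have := Nat.one_le_pow 2 (2 * v + 12) (by omega)
    rw [padeLoss]
    omega
  exact this.trans (Nat.le_add_left _ _)

theorem mul_add_sqrt_le_of_le_add {μ K L σ ℓ : ℝ} (hμ : 0 ≤ μ) (hK : 0 ≤ K) (hL : 1 ≤ L)
    (hℓ : 0 ≤ ℓ) (hσ : σ ≤ ℓ + L) :
    μ * σ + K * (√σ + 1) ≤ μ * ℓ + ((μ + K) * L + K) * (√ℓ + 1) := by
  have hsqrt : √σ ≤ √ℓ + L := by
    refine Real.sqrt_le_iff.mpr ⟨by positivity, ?_⟩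
    nlinarith [Real.mul_self_sqrt hℓ, Real.sqrt_nonneg ℓ]
  calc μ * σ + K * (√σ + 1) ≤ μ * (ℓ + L) + K * (√ℓ + L + 1) := by gcongr
    _ ≤ μ * ℓ + ((μ + K) * L + K) * (√ℓ + 1) := by
        linarith [show 0 ≤ (μ + K) * L * √ℓ by positivity]

theorem approxExponent_mul_add_le_of_le_add {σ ℓ : ℝ} {v : ℕ} (hℓ : 0 ≤ ℓ)
    (hσ : σ ≤ ℓ + (padeThreshold v + v + 3 : ℕ)) :
    approxExponent * σ + padeLoss v * (√σ + 1) ≤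
      approxExponent * ℓ + errorCoeff v * (√ℓ + 1) := by
  refine (mul_add_sqrt_le_of_le_add approxExponent_nonneg (Nat.cast_nonneg _) ?_ hℓ hσ).trans ?_
  · exact_mod_cast Nat.le_add_left 1 _
  · rw [errorCoeff, Nat.cast_add (_ * _), Nat.cast_mul, Nat.cast_add 3, Nat.cast_ofNat]
    gcongr
    exact approxExponent_le_three

variable {d u N : ℤ} {v s : ℕ}

-- Since `d^s / N = d^(s + J) / (N d^J)`, small values of `s` are covered by the bound for large
-- ones.
theorem rpow_neg_add_padeThreshold_le_abs_qExp_sub (hd : 2 ≤ |(d : ℝ)|) (hv : 1 ≤ v) (hu : u ≠ 0)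
    (ht : |(u : ℝ) / v| < 1) (hN0 : N ≠ 0) (hN : |(N : ℝ)| ≤ 32 * |(d : ℝ)| ^ s) :
    |(d : ℝ)| ^ (-(approxExponent * (s + padeThreshold v : ℕ) +
        padeLoss v * (√(s + padeThreshold v : ℕ) + 1))) ≤
      |qExp (d : ℝ)⁻¹ (u / v) - (d : ℝ) ^ s / N| := by
  have hd0 : (d : ℝ) ≠ 0 := abs_pos.mp (two_pos.trans_le hd)
  have hbound : |((N * d ^ padeThreshold v : ℤ) : ℝ)| ≤
      32 * |(d : ℝ)| ^ (s + padeThreshold v) := by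
    push_cast
    rw [abs_mul, abs_pow, pow_add, ← mul_assoc]
    gcongr
  have hfrac : (d : ℝ) ^ (s + padeThreshold v) / ((N * d ^ padeThreshold v : ℤ) : ℝ) =
      (d : ℝ) ^ s / N := by
    push_cast
    rw [pow_add, mul_div_mul_right _ _ (pow_ne_zero _ hd0)]
  rw [← hfrac]
  exact rpow_neg_le_abs_qExp_sub hd hv hu ht (Nat.le_add_left _ _)
    (mul_ne_zero hN0 (pow_ne_zero _ (Int.cast_ne_zero.mp hd0))) hbound

theorem natCast_le_logb_add {D A : ℝ} (hD : 2 ≤ D) (hA : 0 < A) (h : D ^ s / A ≤ 9 * v) :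
    (s : ℝ) ≤ Real.logb D (2 * A) + (v + 3) := by
  have hD1 : 1 < D := by linarith
  have hpow : D ^ s ≤ 2 * A * D ^ (v + 3) :=
    calc D ^ s ≤ 9 * v * A := (div_le_iff₀ hA).mp h
      _ ≤ 2 * A * (v * 2 ^ 3) := by nlinarith [show 0 ≤ v * A by positivity]
      _ ≤ 2 * A * (D ^ v * D ^ 3) := by
          gcongr
          exact natCast_le_pow_of_two_le hD v
      _ = 2 * A * D ^ (v + 3) := by rw [pow_add]
  have hlog := Real.logb_le_logb_of_le hD1 (by positivity) hpow
  rw [Real.logb_mul (by positivity) (by positivity), Real.logb_pow, Real.logb_pow,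
    Real.logb_self_eq_one hD1] at hlog
  push_cast at hlog
  linarith

theorem rpow_neg_le_one_div_of_five_le {D e : ℝ} (hD : 2 ≤ D) (he : 5 ≤ e) :
    D ^ (-e) ≤ 1 / 32 :=
  calc D ^ (-e) ≤ D ^ (-((5 : ℕ) : ℝ)) :=
        Real.rpow_le_rpow_of_exponent_le (by linarith) (neg_le_neg (by exact_mod_cast he))
    _ = (D ^ 5)⁻¹ := by rw [Real.rpow_neg (by linarith), Real.rpow_natCast]
    _ ≤ (2 ^ 5)⁻¹ := by gcongr
    _ = 1 / 32 := by norm_num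

theorem rpow_neg_logb_le_abs_qExp_sub (hd : 2 ≤ |(d : ℝ)|) (hv : 1 ≤ v) (hu : u ≠ 0)
    (ht : |(u : ℝ) / v| < 1) (hN0 : N ≠ 0) (s : ℕ) :
    |(d : ℝ)| ^ (-(approxExponent * Real.logb |(d : ℝ)| (2 * |(N : ℝ)|) +
        errorCoeff v * (√(Real.logb |(d : ℝ)| (2 * |(N : ℝ)|)) + 1))) ≤
      |qExp (d : ℝ)⁻¹ (u / v) - (d : ℝ) ^ s / N| := by
  have hN1 : (1 : ℝ) ≤ |(N : ℝ)| := by exact_mod_cast Int.one_le_abs hN0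
  have hlower := one_div_sixteen_le_abs_qExp (abs_inv_le_half hd) ht
  have hupper := abs_qExp_div_le (abs_inv_le_half hd) hv ht
  have hℓ : 0 ≤ Real.logb |(d : ℝ)| (2 * |(N : ℝ)|) :=
    Real.logb_nonneg (by linarith) (by linarith)
  rcases le_or_gt (|qExp (d : ℝ)⁻¹ (u / v)| / 2) |qExp (d : ℝ)⁻¹ (u / v) - (d : ℝ) ^ s / N|
    with hfar | hnear
  · refine (rpow_neg_le_one_div_of_five_le hd ?_).trans (by linarith)
    have herror : (5 : ℝ) ≤ errorCoeff v := by exact_mod_cast five_le_errorCoeff v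
    nlinarith [mul_nonneg approxExponent_nonneg hℓ, Real.sqrt_nonneg
      (Real.logb |(d : ℝ)| (2 * |(N : ℝ)|))]
  · have hquot : |(d : ℝ) ^ s / N| = |(d : ℝ)| ^ s / |(N : ℝ)| := by rw [abs_div, abs_pow]
    have hquot_ge : 1 / 32 ≤ |(d : ℝ)| ^ s / |(N : ℝ)| := by
      linarith [abs_sub_abs_le_abs_sub (qExp (d : ℝ)⁻¹ (u / v)) ((d : ℝ) ^ s / N)]
    have hquot_le : |(d : ℝ)| ^ s / |(N : ℝ)| ≤ 9 * v := by
      linarith [abs_sub_abs_le_abs_sub ((d : ℝ) ^ s / N) (qExp (d : ℝ)⁻¹ (u / v)),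
        abs_sub_comm ((d : ℝ) ^ s / N) (qExp (d : ℝ)⁻¹ (u / v))]
    have hs := natCast_le_logb_add hd (zero_lt_one.trans_le hN1) hquot_le
    rw [le_div_iff₀ (by linarith)] at hquot_ge
    refine (Real.rpow_le_rpow_of_exponent_le (by linarith) (neg_le_neg ?_)).trans
      (rpow_neg_add_padeThreshold_le_abs_qExp_sub hd hv hu ht hN0 (by linarith))
    refine approxExponent_mul_add_le_of_le_add hℓ ?_
    push_cast
    linarith

end LowerBound

section MainTheorem

/-- The error term `ε₂(d, v, N)` in the exponent of the main theorem: a multiple of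
`ℓ^(-1/2) + ℓ^(-1)` with `ℓ = log_|d| (2 |N|)`. -/
noncomputable def approxError (d : ℤ) (v : ℕ) (N : ℤ) : ℝ :=
  errorCoeff v *
    ((√(Real.logb |(d : ℝ)| (2 * |(N : ℝ)|)))⁻¹ + (Real.logb |(d : ℝ)| (2 * |(N : ℝ)|))⁻¹)

theorem logb_two_mul_abs_pos {D : ℝ} (hD : 1 < D) {N : ℤ} (hN : N ≠ 0) :
    0 < Real.logb D (2 * |(N : ℝ)|) := by
  have hN1 : (1 : ℝ) ≤ |(N : ℝ)| := by exact_mod_cast Int.one_le_abs hN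
  exact Real.logb_pos hD (by linarith)

theorem approxError_pos {d N : ℤ} (hd : 1 < |(d : ℝ)|) (hN : N ≠ 0) (v : ℕ) :
    0 < approxError d v N := by
  have hℓ := logb_two_mul_abs_pos hd hN
  have herror := (five_le_errorCoeff v).trans_lt' (by norm_num : 0 < 5)
  rw [approxError]
  positivity

theorem tendsto_logb_two_mul_abs {D : ℝ} (hD : 1 < D) :
    Tendsto (fun N : ℤ => Real.logb D (2 * |(N : ℝ)|)) (comap (fun N : ℤ => |N|) atTop) atTop := by
  have htwo : Tendsto (fun N : ℤ => 2 * ((|N| : ℤ) : ℝ)) (comap (fun N : ℤ => |N|) atTop) atTop :=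
    ((tendsto_intCast_atTop_atTop (R := ℝ)).comp tendsto_comap).const_mul_atTop two_pos
  simpa [Function.comp_def] using (Real.tendsto_logb_atTop hD).comp htwo

theorem tendsto_approxError {d : ℤ} (hd : 1 < |(d : ℝ)|) (v : ℕ) :
    Tendsto (approxError d v) (comap (fun N : ℤ => |N|) atTop) (𝓝 0) := by
  have hℓ := tendsto_logb_two_mul_abs hd
  have hsqrt := (tendsto_inv_atTop_zero.comp Real.tendsto_sqrt_atTop).comp hℓ
  have hsum := (hsqrt.add (tendsto_inv_atTop_zero.comp hℓ)).const_mul (errorCoeff v : ℝ)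
  rw [add_zero, mul_zero] at hsum
  exact hsum

theorem two_mul_abs_rpow_neg_eq {d N : ℤ} (hd : 1 < |(d : ℝ)|) (hN : N ≠ 0) (v : ℕ) :
    (2 * |(N : ℝ)|) ^ (-(approxExponent + approxError d v N)) =
      |(d : ℝ)| ^ (-(approxExponent * Real.logb |(d : ℝ)| (2 * |(N : ℝ)|) +
        errorCoeff v * (√(Real.logb |(d : ℝ)| (2 * |(N : ℝ)|)) + 1))) := by
  have hN_pos : 0 < 2 * |(N : ℝ)| := by positivity
  have hℓ_pos := logb_two_mul_abs_pos hd hN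
  have hbase : |(d : ℝ)| ^ Real.logb |(d : ℝ)| (2 * |(N : ℝ)|) = 2 * |(N : ℝ)| :=
    Real.rpow_logb (by linarith) hd.ne' hN_pos
  rw [approxError]
  set ℓ := Real.logb |(d : ℝ)| (2 * |(N : ℝ)|)
  have hsqrt : ℓ * (√ℓ)⁻¹ = √ℓ := by rw [← div_eq_mul_inv, Real.div_sqrt]
  have hinv : ℓ * ℓ⁻¹ = 1 := mul_inv_cancel₀ hℓ_pos.ne'
  rw [← hbase, ← Real.rpow_mul (abs_nonneg _)]
  congr 1
  linear_combination -(errorCoeff v : ℝ) * hsqrt - (errorCoeff v : ℝ) * hinv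

theorem effectiveConstant_one : EffectiveConstant fun _ _ => 1 := by
  refine ⟨fun x => ((x.2.2 + 1 : ℕ) : ℤ), ?_, fun d v n => ?_⟩
  · have hsucc : Computable fun x : ℤ × ℕ × ℕ => x.2.2 + 1 :=
      Computable.succ.comp (Computable.snd.comp Computable.snd)
    -- `Encodable.encode (n : ℤ)` is `2 * n`.
    have hcast : Primrec fun n : ℕ => (n : ℤ) :=
      Primrec.encode_iff.mp (Primrec.nat_mul.comp (Primrec.const 2) Primrec.id)
    exact hcast.to_comp.comp hsucc
  · have hn : (n : ℝ) + 1 ≠ 0 := by positivity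
    push_cast
    rw [div_self hn, sub_self, abs_zero]
    positivity

theorem theorem2_general :
    ∃ ε₂ : ℤ → ℕ → ℤ → ℝ, ∀ (d : ℤ) (v : ℕ), 2 ≤ |d| → 1 ≤ v →
      (∀ N : ℤ, N ≠ 0 → 0 < ε₂ d v N) ∧
      Tendsto (ε₂ d v) (comap (fun N : ℤ => |N|) atTop) (𝓝 0) ∧
      ∀ u : ℤ, u ≠ 0 → |(u : ℝ) / v| < 1 → ∀ (s : ℕ) (N : ℤ), N ≠ 0 →
        (2 * |(N : ℝ)|) ^ (-(2 + 1 / (3 + 2 * √3) + ε₂ d v N)) ≤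
          |qExp (1 / (d : ℝ)) (u / v) - (d : ℝ) ^ s / N| := by
  refine ⟨approxError, fun d v hd hv => ?_⟩
  have hd2 : 2 ≤ |(d : ℝ)| := by exact_mod_cast hd
  have hd1 : 1 < |(d : ℝ)| := one_lt_two.trans_le hd2
  refine ⟨fun N hN => approxError_pos hd1 hN v, tendsto_approxError hd1 v,
    fun u hu ht s N hN => ?_⟩
  rw [one_div (d : ℝ)]
  exact (two_mul_abs_rpow_neg_eq hd1 hN v).trans_le
    (rpow_neg_logb_le_abs_qExp_sub hd2 hv hu ht hN s)

end MainTheorem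

theorem theorem2 :
    ∃ C₂ : ℤ → ℕ → ℝ, EffectiveConstant C₂ ∧
    ∃ ε₂ : ℤ → ℕ → ℤ → ℝ,
      ∀ (d : ℤ) (v : ℕ), 2 ≤ |d| → 1 ≤ v →
        0 < C₂ d v ∧
        (∀ N : ℤ, 82836 ≤ |N| → 0 < ε₂ d v N) ∧
        Tendsto (ε₂ d v) (comap (fun N : ℤ => |N|) atTop) (𝓝 0) ∧
        ∀ u : ℤ, Int.gcd u v = 1 → 0 < |(u : ℝ) / (v : ℝ)| → |(u : ℝ) / (v : ℝ)| < 1 →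
          ∀ (s : ℕ) (N : ℤ), 0 < s → 82836 ≤ |N| →
            C₂ d v * (2 * |(N : ℝ)|) ^ (-(2 + 1 / (3 + 2 * √3) + ε₂ d v N)) ≤
              |qExp (1 / (d : ℝ)) ((u : ℝ) / (v : ℝ)) - (d : ℝ) ^ s / (N : ℝ)| := by
  obtain ⟨ε₂, hε₂⟩ := theorem2_general
  have hN0 {N : ℤ} (hN : 82836 ≤ |N|) : N ≠ 0 := abs_pos.mp (by linarith)
  refine ⟨fun _ _ => 1, effectiveConstant_one, ε₂, fun d v hd hv => ?_⟩
  obtain ⟨hpos, hlim, hbound⟩ := hε₂ d v hd hv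
  refine ⟨one_pos, fun N hN => hpos N (hN0 hN), hlim, fun u _ hu ht s N _ hN => ?_⟩
  rw [one_mul]
  exact hbound u (by rintro rfl; simp at hu) ht s N (hN0 hN)
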